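/- Let $m \ge 2$ and $n \ge 0$, and let $X$ be a complex manifold of dimension $m$ (Hausdorff and paracompact). Let $A, B \subseteq X$ be open subsets with $X = A \cup B$ such that $C := A \cap B$ is biholomorphic to $\mathbf{C}^m \setminus \{0\}$. Let $\pi_A : E_A \to A$ and $\pi_B : E_B \to B$ be holomorphic vector bundles of rank $n$ that are holomorphically trivial over $C$, and let $$F : E_A|_C \to C \times \mathbf{C}^n, \qquad G_0, G_1 : E_B|_C \to C \times \mathbf{C}^n$$ be holomorphic trivializations. For $i = 0, 1$ let $$E_i = (E_A \sqcup E_B)/\sim_i$$ be the vector bundle over $X$ obtained by gluing, where $\sim_i$ is the equivalence relation generated by $u \sim_i w$ whenever $u \in E_A|_C$, $w \in E_B|_C$ and $F(u) = G_i(w)$, and $E_i$ carries the quotient topology, the induced projection to $X$, and the vector space structures on its fibres for which the inclusions of the fibres of $E_A$ and $E_B$ are linear. Then $E_0$ and $E_1$ are topologically equivalent vector bundles: there is a homeomorphism $E_0 \to E_1$ that covers the identity of $X$ and is a $\mathbf{C}$-linear isomorphism on each fibre. -/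

import Mathlib

open Bundle Set TopologicalSpace Topology
open scoped Manifold ContDiff

set_option linter.unusedSectionVars false

noncomputable section

namespace BundleGluing

/-! ### Trivializations over a subset of the base -/

/-- A (topological, fibrewise linear) trivialization over the subset `S` of the base `Y` of a
complex vector bundle `E` with model fibre `V`. -/
structure LinearTrivialization {Y : Type*} [TopologicalSpace Y] (V : Type*)
    [NormedAddCommGroup V] [NormedSpace ℂ V] (E : Y → Type*)
    [TopologicalSpace (TotalSpace V E)] [∀ y, AddCommGroup (E y)] [∀ y, Module ℂ (E y)]
    (S : Set Y) extends Trivialization V (π V E) where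
  baseSet_eq : baseSet = S
  isLinear : toTrivialization.IsLinear ℂ

namespace LinearTrivialization

variable {Y : Type*} [TopologicalSpace Y] {V : Type*} [NormedAddCommGroup V] [NormedSpace ℂ V]
  {E : Y → Type*} [TopologicalSpace (TotalSpace V E)] [∀ y, AddCommGroup (E y)]
  [∀ y, Module ℂ (E y)] {S : Set Y}

/-- The linear isomorphism `E y ≃ V` given by a trivialization at a point `y ∈ S`. -/
def fiberEquiv (T : LinearTrivialization V E S) (y : Y) (hy : y ∈ S) : E y ≃ₗ[ℂ] V :=
  haveI := T.isLinear
  T.toTrivialization.linearEquivAt ℂ y (by rw [T.baseSet_eq]; exact hy)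

theorem fiberEquiv_apply (T : LinearTrivialization V E S) (y : Y) (hy : y ∈ S) (u : E y) :
    T.fiberEquiv y hy u = (T.toTrivialization ⟨y, u⟩).2 := rfl

/-- A trivialization of a holomorphic vector bundle over an open set `S` is holomorphic if it is a
biholomorphic map from the part of the total space over `S` onto `S × V`. -/
structure IsHolomorphic {M : Type*} [NormedAddCommGroup M] [NormedSpace ℂ M] [ChartedSpace M Y]
    [∀ y, TopologicalSpace (E y)] [FiberBundle V E] (T : LinearTrivialization V E S) : Prop where
  contMDiffOn : ContMDiffOn (𝓘(ℂ, M).prod 𝓘(ℂ, V)) (𝓘(ℂ, M).prod 𝓘(ℂ, V)) ω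
    T.toTrivialization T.source
  contMDiffOn_symm : ContMDiffOn (𝓘(ℂ, M).prod 𝓘(ℂ, V)) (𝓘(ℂ, M).prod 𝓘(ℂ, V)) ω
    T.toOpenPartialHomeomorph.symm T.target

end LinearTrivialization

/-! ### Topological equivalence of vector bundles -/

/-- Two topological complex vector bundles over the same base are topologically equivalent if there
is a homeomorphism of the total spaces that covers the identity of the base and is a linear
isomorphism on each fibre. -/
def TopologicallyEquivalent {X : Type*} [TopologicalSpace X] (V : Type*) [NormedAddCommGroup V]
    [NormedSpace ℂ V] (E E' : X → Type*)
    [∀ x, AddCommGroup (E x)] [∀ x, Module ℂ (E x)] [∀ x, TopologicalSpace (E x)]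
    [TopologicalSpace (TotalSpace V E)] [FiberBundle V E] [VectorBundle ℂ V E]
    [∀ x, AddCommGroup (E' x)] [∀ x, Module ℂ (E' x)] [∀ x, TopologicalSpace (E' x)]
    [TopologicalSpace (TotalSpace V E')] [FiberBundle V E'] [VectorBundle ℂ V E'] : Prop :=
  ∃ φ : ∀ x, E x ≃ₗ[ℂ] E' x,
    IsHomeomorph (fun p : TotalSpace V E => (⟨p.1, φ p.1 p.2⟩ : TotalSpace V E'))

/-! ### Extending a trivialization along an open inclusion -/

section Extend

variable {X : Type*} [TopologicalSpace X] {V : Type*} [NormedAddCommGroup V] [NormedSpace ℂ V]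
  {S : Opens X} {E : S → Type*} [TopologicalSpace (TotalSpace V E)]
  [∀ s, AddCommGroup (E s)] [∀ s, Module ℂ (E s)]
  {P : X → Type*} [TopologicalSpace (TotalSpace V P)]
  [∀ x, AddCommGroup (P x)] [∀ x, Module ℂ (P x)]

/-- The map of total spaces given by linear isomorphisms of the fibres over an open set `S`. -/
def totalMap (V : Type*) (i : ∀ s : S, E s ≃ₗ[ℂ] P s) (z : TotalSpace V E) : TotalSpace V P :=
  ⟨z.1, i z.1 z.2⟩

theorem range_totalMap (i : ∀ s : S, E s ≃ₗ[ℂ] P s) :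
    range (totalMap V i) = π V P ⁻¹' (S : Set X) := by
  ext z
  constructor
  · rintro ⟨y, rfl⟩
    exact y.1.2
  · rcases z with ⟨x, v⟩
    intro hx
    exact ⟨⟨⟨x, hx⟩, (i ⟨x, hx⟩).symm v⟩, by simp [totalMap]⟩

theorem totalMap_injective (i : ∀ s : S, E s ≃ₗ[ℂ] P s) : Function.Injective (totalMap V i) := by
  rintro ⟨⟨x, hx⟩, u⟩ ⟨⟨y, hy⟩, w⟩ h
  have h1 : x = y := congrArg TotalSpace.proj h
  subst h1
  simp only [totalMap, TotalSpace.mk.injEq, heq_eq_eq, true_and, EmbeddingLike.apply_eq_iff_eq] at h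
  rw [h]

/-- The total space over `S` as the preimage of `S`. -/
def totalHomeo (i : ∀ s : S, E s ≃ₗ[ℂ] P s) (hi : IsOpenEmbedding (totalMap V i)) :
    (π V P ⁻¹' (S : Set X)) ≃ₜ TotalSpace V E where
  toFun z := ⟨⟨z.1.1, z.2⟩, (i ⟨z.1.1, z.2⟩).symm z.1.2⟩
  invFun y := ⟨totalMap V i y, y.1.2⟩
  left_inv := by rintro ⟨⟨x, v⟩, hx⟩; simp [totalMap]
  right_inv := by
    rintro ⟨⟨x, hx⟩, v⟩
    exact congrArg (TotalSpace.mk (F := V) (⟨x, hx⟩ : S)) ((i ⟨x, hx⟩).symm_apply_apply v)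
  continuous_toFun := by
    rw [hi.isInducing.continuous_iff]
    convert continuous_subtype_val using 1
    funext z
    rcases z with ⟨⟨x, v⟩, hx⟩
    simp [totalMap]
  continuous_invFun := hi.continuous.subtype_mk _

/-- A local trivialization of a bundle on the nonempty open set `S`, seen as a local trivialization
of a bundle on `X` whose restriction to `S` is identified with it. -/
def extendTrivialization (i : ∀ s : S, E s ≃ₗ[ℂ] P s) (hi : IsOpenEmbedding (totalMap V i))
    (s₀ : S) (e : Trivialization V (π V E)) : Trivialization V (π V P) :=
  haveI : Nonempty (X → V → TotalSpace V E) := ⟨fun _ _ => ⟨s₀, 0⟩⟩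
  haveI : Nonempty (TotalSpace V P → V) := ⟨fun _ => 0⟩
  Trivialization.domExtend (s := (S : Set X))
    (by rw [← range_totalMap i]; exact hi.isOpen_range)
    ((Trivialization.codExtend' S.isOpen e).compHomeomorph (totalHomeo i hi))

theorem extendTrivialization_baseSet (i : ∀ s : S, E s ≃ₗ[ℂ] P s)
    (hi : IsOpenEmbedding (totalMap V i)) (s₀ : S) (e : Trivialization V (π V E)) :
    (extendTrivialization i hi s₀ e).baseSet = Subtype.val '' e.baseSet := rfl

theorem extendTrivialization_apply (i : ∀ s : S, E s ≃ₗ[ℂ] P s)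
    (hi : IsOpenEmbedding (totalMap V i)) (s₀ : S) (e : Trivialization V (π V E))
    (s : S) (v : P s) :
    (extendTrivialization i hi s₀ e ⟨s, v⟩).2 = (e ⟨s, (i s).symm v⟩).2 := by
  have : extendTrivialization i hi s₀ e ⟨s, v⟩ =
      ((e ⟨s, (i s).symm v⟩).1.1, (e ⟨s, (i s).symm v⟩).2) := dif_pos s.2
  rw [this]

theorem extendTrivialization_isLinear (i : ∀ s : S, E s ≃ₗ[ℂ] P s)
    (hi : IsOpenEmbedding (totalMap V i)) (s₀ : S) (e : Trivialization V (π V E))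
    [e.IsLinear ℂ] : (extendTrivialization i hi s₀ e).IsLinear ℂ := by
  constructor
  intro b hb
  rw [extendTrivialization_baseSet] at hb
  obtain ⟨s, hs, rfl⟩ := hb
  simp only [extendTrivialization_apply]
  exact ((e.linearEquivAt ℂ s hs).toLinearMap ∘ₗ (i s).symm.toLinearMap).isLinear

end Extend

/-- Between linear trivializations with finite dimensional fibre, the coordinate changes are
continuous in the operator norm. -/
theorem continuousOn_coordChangeL {X : Type*} [TopologicalSpace X] {V : Type*}
    [NormedAddCommGroup V] [NormedSpace ℂ V] [FiniteDimensional ℂ V] {P : X → Type*}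
    [TopologicalSpace (TotalSpace V P)] [∀ x, AddCommGroup (P x)] [∀ x, Module ℂ (P x)]
    (e e' : Trivialization V (π V P)) [e.IsLinear ℂ] [e'.IsLinear ℂ] :
    ContinuousOn (fun b => (e.coordChangeL ℂ e' b : V →L[ℂ] V)) (e.baseSet ∩ e'.baseSet) := by
  rw [continuousOn_clm_apply]
  intro v
  have h1 : ContinuousOn (fun b : X => (e' (e.toOpenPartialHomeomorph.symm (b, v))).2)
      (e.baseSet ∩ e'.baseSet) := by
    refine continuous_snd.comp_continuousOn (e'.continuousOn.comp
      (e.continuousOn_symm_prodMk_left.mono inter_subset_left) ?_)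
    intro b hb
    rw [e'.mem_source, e.proj_symm_apply' hb.1]
    exact hb.2
  refine h1.congr fun b hb => ?_
  exact e.coordChangeL_apply' e' hb v

/-- The points of one bundle that a gluing over the overlap of `S` and `T` identifies with a point
of an open set `U` of the other bundle form an open set. -/
theorem isOpen_identified {X : Type*} [TopologicalSpace X] {S T : Opens X}
    {V : Type*} [NormedAddCommGroup V] [NormedSpace ℂ V]
    {E : S → Type*} [TopologicalSpace (TotalSpace V E)] [∀ s, AddCommGroup (E s)]
    [∀ s, Module ℂ (E s)]
    {E' : T → Type*} [TopologicalSpace (TotalSpace V E')] [∀ t, AddCommGroup (E' t)]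
    [∀ t, Module ℂ (E' t)] [∀ t, TopologicalSpace (E' t)] [FiberBundle V E']
    (F : LinearTrivialization V E {s : S | (s : X) ∈ T})
    (G : LinearTrivialization V E' {t : T | (t : X) ∈ S})
    {U : Set (TotalSpace V E)} (hU : IsOpen U) :
    IsOpen {y : TotalSpace V E' | ∃ (h : (y.1 : X) ∈ S) (u : E ⟨y.1, h⟩),
      (⟨⟨y.1, h⟩, u⟩ : TotalSpace V E) ∈ U ∧
        F.fiberEquiv ⟨y.1, h⟩ y.1.2 u = G.fiberEquiv y.1 h y.2} := by
  have hW : IsOpen (Prod.map (Subtype.val : S → X) (id : V → V) ''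
      (F.toOpenPartialHomeomorph '' (F.source ∩ U))) :=
    S.isOpen.isOpenMap_subtype_val.prodMap .id _
      (F.toOpenPartialHomeomorph.isOpen_image_source_inter hU)
  have hc : ContinuousOn (fun y : TotalSpace V E' => ((y.1 : X), (G.toTrivialization y).2))
      G.source :=
    ((continuous_subtype_val.comp (FiberBundle.continuous_proj V E')).continuousOn).prodMk
      (continuous_snd.comp_continuousOn G.continuousOn)
  convert hc.isOpen_inter_preimage G.open_source hW using 1
  ext y
  have hG : y ∈ G.source ↔ (y.1 : X) ∈ S := by
    rw [G.toTrivialization.mem_source, G.baseSet_eq]; rfl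
  constructor
  · rintro ⟨h, u, hu, he⟩
    have hs : (⟨⟨y.1, h⟩, u⟩ : TotalSpace V E) ∈ F.source := by
      rw [F.toTrivialization.mem_source, F.baseSet_eq]; exact y.1.2
    refine ⟨hG.2 h, _, ⟨_, ⟨hs, hu⟩, rfl⟩, ?_⟩
    refine Prod.ext ?_ he
    exact congrArg Subtype.val (F.toTrivialization.coe_fst hs)
  · rintro ⟨hy, _, ⟨⟨⟨s, u⟩, ⟨hs, hu⟩, rfl⟩, hp⟩⟩
    have h1 : (s : X) = y.1 :=
      (congrArg Subtype.val (F.toTrivialization.coe_fst hs)).symm.trans (congrArg Prod.fst hp)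
    have h2 : (F.toTrivialization ⟨s, u⟩).2 = (G.toTrivialization y).2 := congrArg Prod.snd hp
    have h := hG.1 hy
    obtain rfl : s = ⟨y.1, h⟩ := Subtype.ext h1
    exact ⟨h, u, hu, h2⟩

/-! ### Gluing -/

section Glue

variable {X : Type*} [TopologicalSpace X] {A B : Opens X}
  {V : Type*} [NormedAddCommGroup V] [NormedSpace ℂ V]
  {EA : A → Type*} [TopologicalSpace (TotalSpace V EA)] [∀ a, AddCommGroup (EA a)]
  [∀ a, Module ℂ (EA a)]
  {EB : B → Type*} [TopologicalSpace (TotalSpace V EB)] [∀ b, AddCommGroup (EB b)]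
  [∀ b, Module ℂ (EB b)]

/-- The part of the disjoint union of `E_A` and `E_B` that lies over the point `x` of `X`. -/
abbrev PreFiber (EA : A → Type*) (EB : B → Type*) (x : X) : Type _ :=
  (Σ' h : x ∈ A, EA ⟨x, h⟩) ⊕ (Σ' h : x ∈ B, EB ⟨x, h⟩)

/-- A point `u` of `E_A` and a point `w` of `E_B` over the same point of `A ∩ B` are identified
when `F u = G w`. -/
def glueRel (F : LinearTrivialization V EA {a : A | (a : X) ∈ B})
    (G : LinearTrivialization V EB {b : B | (b : X) ∈ A}) (x : X) :
    PreFiber EA EB x → PreFiber EA EB x → Prop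
  | .inl u, .inr w => F.fiberEquiv ⟨x, u.1⟩ w.1 u.2 = G.fiberEquiv ⟨x, w.1⟩ u.1 w.2
  | _, _ => False

/-- The fibre at `x` of the bundle `E_A ∪_{F = G} E_B` glued from `E_A` and `E_B`, where `A` and `B`
cover `X`: the quotient of the disjoint union of `E_A` and `E_B` over `x` by the equivalence
relation generated by `u ∼ w` if `F u = G w`. -/
def Glued (_hAB : A ⊔ B = ⊤) (F : LinearTrivialization V EA {a : A | (a : X) ∈ B})
    (G : LinearTrivialization V EB {b : B | (b : X) ∈ A}) (x : X) : Type _ :=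
  Quot (glueRel F G x)

variable (hAB : A ⊔ B = ⊤) (F : LinearTrivialization V EA {a : A | (a : X) ∈ B})
  (G : LinearTrivialization V EB {b : B | (b : X) ∈ A})

theorem mem_right_of_not_mem_left {X : Type*} [TopologicalSpace X] {A B : Opens X}
    (hAB : A ⊔ B = ⊤) {x : X} (h : x ∉ A) : x ∈ B := by
  have : x ∈ A ⊔ B := by rw [hAB]; trivial
  rcases this with h' | h'
  · exact absurd h' h
  · exact h'

/-- The fibre of `E_A` at a point of `A` is the fibre of the glued bundle. -/
def equivA (x : X) (h : x ∈ A) : EA ⟨x, h⟩ ≃ Glued hAB F G x where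
  toFun u := Quot.mk _ (.inl ⟨h, u⟩)
  invFun := Quot.lift
    (fun
      | .inl u => u.2
      | .inr w => (F.fiberEquiv ⟨x, h⟩ w.1).symm (G.fiberEquiv ⟨x, w.1⟩ h w.2))
    (by
      rintro (u | u) (w | w) hr
      · exact hr.elim
      · rw [LinearEquiv.eq_symm_apply]; exact hr
      · exact hr.elim
      · exact hr.elim)
  left_inv u := rfl
  right_inv := by
    rintro ⟨u | w⟩
    · rfl
    · refine Quot.sound ?_
      exact (F.fiberEquiv ⟨x, h⟩ w.1).apply_symm_apply (G.fiberEquiv ⟨x, w.1⟩ h w.2)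

/-- The fibre of `E_B` at a point of `B` is the fibre of the glued bundle. -/
def equivB (x : X) (h : x ∈ B) : EB ⟨x, h⟩ ≃ Glued hAB F G x where
  toFun w := Quot.mk _ (.inr ⟨h, w⟩)
  invFun := Quot.lift
    (fun
      | .inl u => (G.fiberEquiv ⟨x, h⟩ u.1).symm (F.fiberEquiv ⟨x, u.1⟩ h u.2)
      | .inr w => w.2)
    (by
      rintro (u | u) (w | w) hr
      · exact hr.elim
      · rw [LinearEquiv.symm_apply_eq]; exact hr
      · exact hr.elim
      · exact hr.elim)
  left_inv u := rfl
  right_inv := by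
    rintro ⟨u | w⟩
    · refine (Quot.sound ?_).symm
      exact ((G.fiberEquiv ⟨x, h⟩ u.1).apply_symm_apply (F.fiberEquiv ⟨x, u.1⟩ h u.2)).symm
    · rfl

theorem equivB_eq_equivA (x : X) (hA : x ∈ A) (hB : x ∈ B) (w : EB ⟨x, hB⟩) :
    equivB hAB F G x hB w =
      equivA hAB F G x hA ((F.fiberEquiv ⟨x, hA⟩ hB).symm (G.fiberEquiv ⟨x, hB⟩ hA w)) := by
  refine (Quot.sound ?_).symm
  exact (F.fiberEquiv ⟨x, hA⟩ hB).apply_symm_apply _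

variable [∀ a, TopologicalSpace (EA a)] [FiberBundle V EA] [VectorBundle ℂ V EA]
  [∀ b, TopologicalSpace (EB b)] [FiberBundle V EB] [VectorBundle ℂ V EB]

open scoped Classical in
/-- A bijection of the fibre at `x` of the glued bundle with the model fibre, used to write down the
vector space structure. -/
def fiberChart (x : X) : Glued hAB F G x ≃ V :=
  if h : x ∈ A then
    (equivA hAB F G x h).symm.trans ((trivializationAt V EA ⟨x, h⟩).linearEquivAt ℂ ⟨x, h⟩
      (mem_baseSet_trivializationAt V EA ⟨x, h⟩)).toEquiv
  else
    (equivB hAB F G x (mem_right_of_not_mem_left hAB h)).symm.trans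
      ((trivializationAt V EB ⟨x, mem_right_of_not_mem_left hAB h⟩).linearEquivAt ℂ
        ⟨x, mem_right_of_not_mem_left hAB h⟩ (mem_baseSet_trivializationAt V EB _)).toEquiv

/-- The vector space structure on the fibres of the glued bundle. It is the one for which the
inclusions of the fibres of `E_A` and `E_B` are linear, see `inclA` and `inclB`. -/
instance instAddCommGroupGlued (x : X) : AddCommGroup (Glued hAB F G x) := (fiberChart hAB F G x).addCommGroup

instance instModuleGlued (x : X) : Module ℂ (Glued hAB F G x) := (fiberChart hAB F G x).module ℂ

/-- `fiberChart` as a linear isomorphism. -/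
def fiberChartL (x : X) : Glued hAB F G x ≃ₗ[ℂ] V := (fiberChart hAB F G x).linearEquiv ℂ

/-- The inclusion of the fibre of `E_A` at a point of `A` in the glued bundle. -/
def inclA (a : A) : EA a ≃ₗ[ℂ] Glued hAB F G a :=
  { equivA hAB F G a a.2 with
    map_add' := fun u v => by
      change equivA hAB F G a a.2 (u + v) =
        equivA hAB F G a a.2 u + equivA hAB F G a a.2 v
      apply (fiberChartL hAB F G a).injective
      rw [LinearEquiv.map_add (fiberChartL hAB F G a)]
      change fiberChart hAB F G a _ = fiberChart hAB F G a _ + fiberChart hAB F G a _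
      simp [fiberChart, a.2, -Trivialization.linearEquivAt_apply]
    map_smul' := fun c u => by
      change equivA hAB F G a a.2 (c • u) = c • equivA hAB F G a a.2 u
      apply (fiberChartL hAB F G a).injective
      rw [LinearEquiv.map_smul (fiberChartL hAB F G a)]
      change fiberChart hAB F G a _ = c • fiberChart hAB F G a _
      simp [fiberChart, a.2, -Trivialization.linearEquivAt_apply] }

theorem inclA_apply (a : A) (u : EA a) :
    inclA hAB F G a u = Quot.mk _ (.inl ⟨a.2, u⟩) := rfl

/-- The inclusion of the fibre of `E_B` at a point of `B` in the glued bundle. -/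
def inclB (b : B) : EB b ≃ₗ[ℂ] Glued hAB F G b :=
  { equivB hAB F G b b.2 with
    map_add' := fun u v => by
      change equivB hAB F G b b.2 (u + v) =
        equivB hAB F G b b.2 u + equivB hAB F G b b.2 v
      by_cases h : (b : X) ∈ A
      · simp only [equivB_eq_equivA hAB F G b h b.2, map_add]
        exact (inclA hAB F G ⟨b, h⟩).map_add _ _
      · apply (fiberChartL hAB F G b).injective
        rw [LinearEquiv.map_add (fiberChartL hAB F G b)]
        change fiberChart hAB F G b _ = fiberChart hAB F G b _ + fiberChart hAB F G b _
        simp [fiberChart, h, -Trivialization.linearEquivAt_apply]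
    map_smul' := fun c u => by
      change equivB hAB F G b b.2 (c • u) = c • equivB hAB F G b b.2 u
      by_cases h : (b : X) ∈ A
      · simp only [equivB_eq_equivA hAB F G b h b.2, map_smul]
        exact (inclA hAB F G ⟨b, h⟩).map_smul _ _
      · apply (fiberChartL hAB F G b).injective
        rw [LinearEquiv.map_smul (fiberChartL hAB F G b)]
        change fiberChart hAB F G b _ = c • fiberChart hAB F G b _
        simp [fiberChart, h, -Trivialization.linearEquivAt_apply] }

theorem inclB_apply (b : B) (w : EB b) :
    inclB hAB F G b w = Quot.mk _ (.inr ⟨b.2, w⟩) := rfl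

theorem inclA_eq_inclB_iff (x : X) (hA : x ∈ A) (hB : x ∈ B) (u : EA ⟨x, hA⟩) (w : EB ⟨x, hB⟩) :
    inclA hAB F G ⟨x, hA⟩ u = inclB hAB F G ⟨x, hB⟩ w ↔
      F.fiberEquiv ⟨x, hA⟩ hB u = G.fiberEquiv ⟨x, hB⟩ hA w := by
  have h : inclB hAB F G ⟨x, hB⟩ w =
      inclA hAB F G ⟨x, hA⟩ ((F.fiberEquiv ⟨x, hA⟩ hB).symm (G.fiberEquiv ⟨x, hB⟩ hA w)) :=
    equivB_eq_equivA hAB F G x hA hB w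
  rw [h, EmbeddingLike.apply_eq_iff_eq, LinearEquiv.eq_symm_apply]

/-- The total space of the glued bundle carries the quotient topology of the disjoint union of the
total spaces of `E_A` and `E_B`. -/
instance instTopologicalSpaceTotalSpaceGlued : TopologicalSpace (TotalSpace V (Glued hAB F G)) :=
  TopologicalSpace.coinduced
    (Sum.elim (totalMap V (inclA hAB F G)) (totalMap V (inclB hAB F G))) inferInstance

/-- The fibres carry the subspace topology. -/
instance instTopologicalSpaceGlued (x : X) : TopologicalSpace (Glued hAB F G x) :=
  TopologicalSpace.induced (TotalSpace.mk (F := V) x) inferInstance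

theorem isOpen_glued_iff (U : Set (TotalSpace V (Glued hAB F G))) :
    IsOpen U ↔ IsOpen (totalMap V (inclA hAB F G) ⁻¹' U) ∧
      IsOpen (totalMap V (inclB hAB F G) ⁻¹' U) := by
  rw [isOpen_coinduced, isOpen_sum_iff]
  rfl

theorem continuous_totalMap_inclA : Continuous (totalMap V (inclA hAB F G)) :=
  continuous_def.2 fun U hU => ((isOpen_glued_iff hAB F G U).1 hU).1

theorem continuous_totalMap_inclB : Continuous (totalMap V (inclB hAB F G)) :=
  continuous_def.2 fun U hU => ((isOpen_glued_iff hAB F G U).1 hU).2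

/-- `E_A → E` is an open embedding. -/
theorem isOpenEmbedding_inclA : IsOpenEmbedding (totalMap V (inclA hAB F G)) := by
  refine .of_continuous_injective_isOpenMap (continuous_totalMap_inclA hAB F G)
    (totalMap_injective _) fun U hU => ?_
  rw [isOpen_glued_iff, preimage_image_eq _ (totalMap_injective _)]
  refine ⟨hU, ?_⟩
  convert isOpen_identified F G hU using 1
  ext y
  constructor
  · rintro ⟨⟨⟨x, hA⟩, u⟩, hu, he⟩
    rcases y with ⟨⟨y, hB⟩, w⟩
    obtain rfl : x = y := congrArg TotalSpace.proj he
    refine ⟨hA, u, hu, (inclA_eq_inclB_iff hAB F G x hA hB u w).1 ?_⟩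
    simpa [totalMap] using he
  · rcases y with ⟨⟨y, hB⟩, w⟩
    rintro ⟨h, u, hu, he⟩
    exact ⟨_, hu, congrArg (TotalSpace.mk (F := V) y)
      ((inclA_eq_inclB_iff hAB F G y h hB u w).2 he)⟩

/-- `E_B → E` is an open embedding. -/
theorem isOpenEmbedding_inclB : IsOpenEmbedding (totalMap V (inclB hAB F G)) := by
  refine .of_continuous_injective_isOpenMap (continuous_totalMap_inclB hAB F G)
    (totalMap_injective _) fun U hU => ?_
  rw [isOpen_glued_iff, preimage_image_eq _ (totalMap_injective _)]
  refine ⟨?_, hU⟩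
  convert isOpen_identified G F hU using 1
  ext y
  constructor
  · rintro ⟨⟨⟨x, hB⟩, w⟩, hw, he⟩
    rcases y with ⟨⟨y, hA⟩, u⟩
    obtain rfl : x = y := congrArg TotalSpace.proj he
    refine ⟨hB, w, hw, ((inclA_eq_inclB_iff hAB F G x hA hB u w).1 ?_).symm⟩
    simpa [totalMap] using he.symm
  · rcases y with ⟨⟨y, hA⟩, u⟩
    rintro ⟨h, w, hw, he⟩
    exact ⟨_, hw, congrArg (TotalSpace.mk (F := V) y)
      ((inclA_eq_inclB_iff hAB F G y hA h u w).2 he.symm).symm⟩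

open scoped Classical in
/-- The glued bundle is locally trivial; local trivializations are those of `E_A` and of `E_B`. -/
instance instFiberBundleGlued : FiberBundle V (Glued hAB F G) where
  totalSpaceMk_isInducing' _ := ⟨rfl⟩
  trivializationAtlas' :=
    {t | (∃ e ∈ trivializationAtlas V EA, ∃ a : A,
          t = extendTrivialization (inclA hAB F G) (isOpenEmbedding_inclA hAB F G) a e) ∨
        (∃ e ∈ trivializationAtlas V EB, ∃ b : B,
          t = extendTrivialization (inclB hAB F G) (isOpenEmbedding_inclB hAB F G) b e)}
  trivializationAt' x :=
    if h : x ∈ A then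
      extendTrivialization (inclA hAB F G) (isOpenEmbedding_inclA hAB F G) ⟨x, h⟩
        (trivializationAt V EA ⟨x, h⟩)
    else
      extendTrivialization (inclB hAB F G) (isOpenEmbedding_inclB hAB F G)
        ⟨x, mem_right_of_not_mem_left hAB h⟩
        (trivializationAt V EB ⟨x, mem_right_of_not_mem_left hAB h⟩)
  mem_baseSet_trivializationAt' x := by
    split_ifs with h
    · rw [extendTrivialization_baseSet]
      exact ⟨_, mem_baseSet_trivializationAt V EA ⟨x, h⟩, rfl⟩
    · rw [extendTrivialization_baseSet]
      exact ⟨_, mem_baseSet_trivializationAt V EB ⟨x, mem_right_of_not_mem_left hAB h⟩, rfl⟩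
  trivialization_mem_atlas' x := by
    split_ifs with h
    · exact .inl ⟨_, trivialization_mem_atlas V EA _, _, rfl⟩
    · exact .inr ⟨_, trivialization_mem_atlas V EB _, _, rfl⟩

/-- The glued bundle is a topological complex vector bundle on `X`. -/
instance instVectorBundleGlued [FiniteDimensional ℂ V] :
    VectorBundle ℂ V (Glued hAB F G) := by
  have lin : ∀ (e : Trivialization V (π V (Glued hAB F G))) [MemTrivializationAtlas e],
      e.IsLinear ℂ := by
    intro e he
    rcases he.out with ⟨e', he', a, rfl⟩ | ⟨e', he', a, rfl⟩
    · have : MemTrivializationAtlas e' := ⟨he'⟩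
      exact extendTrivialization_isLinear _ _ _ _
    · have : MemTrivializationAtlas e' := ⟨he'⟩
      exact extendTrivialization_isLinear _ _ _ _
  exact
    { trivialization_linear' := lin
      continuousOn_coordChange' := fun e e' _ _ =>
        haveI := lin e
        haveI := lin e'
        continuousOn_coordChangeL e e' }

end Glue

end BundleGluing

end

/-!
In the trivializations `G₀`, `G₁`, the two gluings differ by the transition function
`g = G₁ ∘ G₀⁻¹ : C → GL_n(ℂ)`, a holomorphic map on `C ≅ ℂᵐ \ {0}`. The bundles are topologically
equivalent because `g` is homotopic to the constant map `1`.

The homotopy exists because `m ≥ 2`. By Hartogs' theorem for a point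
(`exists_tendsto_nhdsNE_of_differentiableOn`), `g` and `g⁻¹` have limits at the origin, so `g`
extends to a continuous map from the contractible space `ℂᵐ` to `GL_n(ℂ)`
(`exists_continuousMap_units_eqOn`). Such a map is homotopic to a constant, and hence to `1`, since
`GL_n(ℂ)` is path connected (`joined_one_units`). Here `GL_n(ℂ)` is the unit group of the Banach
algebra `V →L[ℂ] V`.

Given the homotopy `H` from `1` to `g`, paracompactness of `X` provides a continuous
`ρ : X → [0, 1]` that is `0` near `X \ B` and `1` near `X \ A`. The function `a x = H (ρ x) x` on
`C` is `1` near `A \ B`, and `b = g⁻¹ a` is `1` near `B \ A`. So `a` and `b`, read in `F` and in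
`G₀`, define automorphisms of `E_A` and of `E_B`, extended by the identity
(`LinearTrivialization.continuous_totalMap_autOfUnits`). As `a = g b`, they respect the two gluing
relations and induce the equivalence (`topologicallyEquivalent_glued_of_homotopy`).
-/

/-! ### Removable point singularities in dimension at least two -/

section Removable

open Filter Metric

variable {E W : Type*} [NormedAddCommGroup E] [NormedSpace ℂ E] [NormedAddCommGroup W]
  [NormedSpace ℂ W]

theorem add_smul_ne_zero_of_notMem_span {e w : E} (hw : w ∉ Submodule.span ℂ {e}) (ζ : ℂ) :
    w + ζ • e ≠ 0 := fun h => hw <| by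
  rw [eq_neg_of_add_eq_zero_left h]
  exact neg_mem (Submodule.smul_mem _ _ (Submodule.mem_span_singleton_self e))

/-- The circles `w + ζ • e`, `‖ζ‖ = 1`, avoid the origin as long as `‖w‖ < 1`, so averaging over
them makes sense, and is continuous, across the origin. -/
theorem continuousOn_circleAverage_add_smul {f : E → W} (hf : ContinuousOn f {0}ᶜ) {e : E}
    (he : ‖e‖ = 1) :
    ContinuousOn (fun w => Real.circleAverage (fun ζ => f (w + ζ • e)) 0 1) (ball 0 1) := by
  rw [continuousOn_iff_continuous_domRestrict]
  have hF : Continuous fun p : ball (0 : E) 1 × ℝ => f ((p.1 : E) + circleMap 0 1 p.2 • e) := by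
    refine hf.comp_continuous (by fun_prop) fun p hp => ?_
    have h1 : ‖(p.1 : E)‖ < 1 := mem_ball_zero_iff.1 p.1.2
    have h2 : ‖(p.1 : E)‖ = 1 := by
      rw [eq_neg_of_add_eq_zero_left hp, norm_neg, norm_smul, he, norm_circleMap_zero]
      simp
    exact h1.ne h2
  exact (intervalIntegral.continuous_parametric_intervalIntegral_of_continuous'
    (f := fun (w : ball (0 : E) 1) θ => f ((w : E) + circleMap 0 1 θ • e)) hF 0
    (2 * Real.pi)).const_smul _

variable [CompleteSpace W]

theorem circleAverage_add_smul {f : E → W} (hf : DifferentiableOn ℂ f {0}ᶜ) {e w : E}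
    (hw : w ∉ Submodule.span ℂ {e}) :
    Real.circleAverage (fun ζ => f (w + ζ • e)) 0 1 = f w := by
  have hd : Differentiable ℂ fun ζ : ℂ => f (w + ζ • e) := fun ζ =>
    (hf.differentiableAt (isOpen_compl_singleton.mem_nhds
      (add_smul_ne_zero_of_notMem_span hw ζ))).comp ζ (by fun_prop)
  simpa using hd.diffContOnCl.circleAverage (c := 0) (R := 1)

/-- A point is a removable singularity of a holomorphic function of at least two variables
(Hartogs): by the mean value property, the function equals its averages over the circles
`w + ζ • e`, and those depend continuously on `w` at the origin too. -/
theorem exists_tendsto_nhdsNE_of_differentiableOn {f : E → W} (hf : DifferentiableOn ℂ f {0}ᶜ)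
    {e e' : E} (he : ‖e‖ = 1) (he' : e' ∉ Submodule.span ℂ {e}) :
    ∃ L, Tendsto f (𝓝[≠] 0) (𝓝 L) := by
  set M : E → W := fun w => Real.circleAverage (fun ζ => f (w + ζ • e)) 0 1 with hM
  have hMc : ContinuousOn M (ball 0 1) := continuousOn_circleAverage_add_smul hf.continuousOn he
  have hMf : ∀ w ∈ ball (0 : E) 1, w ≠ 0 → M w = f w := by
    intro w hw hw0
    by_cases hs : w ∈ Submodule.span ℂ {e}
    · -- The mean value property fails on the line through `e`; approximate `w` by `w + t • e'`.
      have ht : Tendsto (fun t : ℂ => w + t • e') (𝓝[≠] 0) (𝓝 w) := by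
        have : Continuous fun t : ℂ => w + t • e' := by fun_prop
        simpa using (this.tendsto 0).mono_left nhdsWithin_le_nhds
      have h1 := (hMc.continuousAt (isOpen_ball.mem_nhds hw)).tendsto.comp ht
      have h2 := (hf.continuousOn.continuousAt
        (isOpen_compl_singleton.mem_nhds hw0)).tendsto.comp ht
      refine tendsto_nhds_unique h1 (h2.congr' ?_)
      filter_upwards [self_mem_nhdsWithin] with t ht
      refine (circleAverage_add_smul hf fun hmem => he' ?_).symm
      have := (Submodule.add_mem_iff_right _ hs).1 hmem
      exact (Submodule.smul_mem_iff _ ht).1 this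
    · exact circleAverage_add_smul hf hs
  refine ⟨M 0, ((hMc.continuousAt (ball_mem_nhds 0 one_pos)).tendsto.mono_left
    nhdsWithin_le_nhds).congr' ?_⟩
  filter_upwards [self_mem_nhdsWithin, mem_nhdsWithin_of_mem_nhds (ball_mem_nhds 0 one_pos)]
    with w hw hw' using hMf w hw' hw

end Removable

/-! ### Maps into the unit group of a Banach algebra -/

section Units

open Filter

variable {R : Type*} [NormedRing R] [NormedAlgebra ℂ R] [CompleteSpace R]

theorem continuous_units_iff_continuous_val {Y : Type*} [TopologicalSpace Y] {f : Y → Rˣ} :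
    Continuous f ↔ Continuous fun y => (f y : R) :=
  Units.isOpenEmbedding_val.continuous_iff

/-- Both `g` and `g⁻¹` extend over the origin, and the two values there are inverse to each
other. -/
theorem exists_continuousMap_units_eqOn {E : Type*} [NormedAddCommGroup E] [NormedSpace ℂ E]
    {g : E → Rˣ} (hg : DifferentiableOn ℂ (fun z => (g z : R)) {0}ᶜ)
    {e e' : E} (he : ‖e‖ = 1) (he' : e' ∉ Submodule.span ℂ {e}) :
    ∃ g' : C(E, Rˣ), EqOn g' g {0}ᶜ := by
  classical
  have hg' : DifferentiableOn ℂ (fun z => (↑(g z)⁻¹ : R)) {0}ᶜ := by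
    have : (fun z => (↑(g z)⁻¹ : R)) = fun z => Ring.inverse (g z : R) := by simp
    rw [this]
    exact fun z hz => (differentiableAt_inverse (𝕜 := ℂ) (g z).isUnit).comp_differentiableWithinAt
      (g := Ring.inverse) z (hg z hz)
  obtain ⟨L, hL⟩ := exists_tendsto_nhdsNE_of_differentiableOn hg he he'
  obtain ⟨L', hL'⟩ := exists_tendsto_nhdsNE_of_differentiableOn hg' he he'
  have : (𝓝[≠] (0 : E)).NeBot := by
    have : Nontrivial E := ⟨e, 0, fun h => by simp [h] at he⟩
    exact Module.punctured_nhds_neBot ℂ E 0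
  let u : Rˣ := ⟨L, L', tendsto_nhds_unique (hL.mul hL') (by simp),
    tendsto_nhds_unique (hL'.mul hL) (by simp)⟩
  refine ⟨⟨Function.update g 0 u, ?_⟩, fun z hz => Function.update_of_ne hz _ _⟩
  rw [continuous_units_iff_continuous_val]
  have hup : (fun z => (Function.update g 0 u z : R)) =
      Function.update (fun z => (g z : R)) 0 L := by
    funext z
    by_cases hz : z = 0
    · subst hz; simp [u]
    · simp [hz]
  rw [hup, continuous_iff_continuousAt]
  intro z
  by_cases hz : z = 0
  · subst hz
    exact continuousAt_update_same.2 hL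
  · exact (continuousAt_update_of_ne hz).2
      (hg.continuousOn.continuousAt (isOpen_compl_singleton.mem_nhds hz))

/-- If every spectrum is finite, the complex line through `1` and a unit `u` leaves the units only
at countably many points, and the complement of a countable set in `ℂ` is path connected. -/
theorem joined_one_units (hR : ∀ a : R, (spectrum ℂ a).Finite) (u : Rˣ) : Joined 1 u := by
  set N : R := u - 1
  let S : Set ℂ := {z | ¬ IsUnit (1 + z • N)}
  have hS : S.Countable := by
    refine ((hR (-N)).image fun z => z⁻¹).countable.mono fun z hz => ?_
    have hz0 : z ≠ 0 := by
      rintro rfl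
      simp [S] at hz
    refine ⟨z⁻¹, fun h => hz ?_, inv_inv z⟩
    have : (1 + z • N : R) = z • (algebraMap ℂ R z⁻¹ - -N) := by
      rw [Algebra.algebraMap_eq_smul_one, smul_sub z (z⁻¹ • (1 : R)) (-N), smul_smul,
        mul_inv_cancel₀ hz0, one_smul, smul_neg, sub_neg_eq_add]
    rw [this]
    exact (isUnit_smul_iff (Units.mk0 z hz0) _).2 h
  have h0 : (0 : ℂ) ∈ Sᶜ := by simp [S]
  have h1 : (1 : ℂ) ∈ Sᶜ := by simp [S, N]
  have hr : 1 < Module.rank ℝ ℂ := by simp [Complex.rank_real_complex]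
  obtain ⟨γ, hγ⟩ := (hS.isPathConnected_compl_of_one_lt_rank hr).joinedIn 0 h0 1 h1
  have hu : ∀ t, IsUnit (1 + γ t • N) := fun t => not_not.1 (hγ t)
  refine ⟨⟨⟨fun t => (hu t).unit, ?_⟩, ?_, ?_⟩⟩
  · rw [continuous_units_iff_continuous_val]
    simp only [IsUnit.unit_spec]
    fun_prop
  · ext; simp
  · ext; simp [N]

theorem homotopic_const_one_units (hR : ∀ a : R, (spectrum ℂ a).Finite) {Y : Type*}
    [TopologicalSpace Y] [ContractibleSpace Y] (g : C(Y, Rˣ)) :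
    (ContinuousMap.const Y 1).Homotopic g := by
  obtain ⟨u, hu⟩ := (id_nullhomotopic Y).comp_right g
  exact (ContinuousMap.homotopic_const_iff.2 (joined_one_units hR u)).trans hu.symm

end Units

theorem finite_spectrum_continuousLinearMap {V : Type*} [NormedAddCommGroup V] [NormedSpace ℂ V]
    [FiniteDimensional ℂ V] (a : V →L[ℂ] V) : (spectrum ℂ a).Finite := by
  have := Module.End.finite_spectrum (K := ℂ) (a : Module.End ℂ V)
  rwa [ContinuousLinearMap.spectrum_eq]

noncomputable section

namespace BundleGluing

/-! ### Automorphisms given by a matrix function in a trivialization -/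

section AutOfUnits

variable {Y : Type*} [TopologicalSpace Y] {V : Type*} [NormedAddCommGroup V] [NormedSpace ℂ V]
  {E : Y → Type*} [TopologicalSpace (TotalSpace V E)] [∀ y, AddCommGroup (E y)]
  [∀ y, Module ℂ (E y)] {S : Set Y}

open scoped Classical in
/-- The automorphism of the fibre at `y` of a bundle trivialized over `S` that is given by the
invertible operator `c y` in the trivialization if `y ∈ S`, and the identity if `y ∉ S`. -/
def LinearTrivialization.autOfUnits (T : LinearTrivialization V E S) (c : Y → (V →L[ℂ] V)ˣ)
    (y : Y) : E y ≃ₗ[ℂ] E y :=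
  if h : y ∈ S then
    (T.fiberEquiv y h).trans
      ((ContinuousLinearEquiv.ofUnit (c y)).toLinearEquiv.trans (T.fiberEquiv y h).symm)
  else LinearEquiv.refl ℂ (E y)

theorem LinearTrivialization.fiberEquiv_autOfUnits (T : LinearTrivialization V E S)
    (c : Y → (V →L[ℂ] V)ˣ) (y : Y) (h : y ∈ S) (u : E y) :
    T.fiberEquiv y h (T.autOfUnits c y u) = (c y : V →L[ℂ] V) (T.fiberEquiv y h u) := by
  simp only [autOfUnits, h, dite_true, LinearEquiv.trans_apply, LinearEquiv.apply_symm_apply]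
  rfl

theorem LinearTrivialization.autOfUnits_eq_refl (T : LinearTrivialization V E S)
    {c : Y → (V →L[ℂ] V)ˣ} {y : Y} (hc : c y = 1) : T.autOfUnits c y = LinearEquiv.refl ℂ (E y) := by
  by_cases h : y ∈ S
  · ext u
    apply (T.fiberEquiv y h).injective
    rw [T.fiberEquiv_autOfUnits, hc]
    rfl
  · simp [autOfUnits, h]

theorem LinearTrivialization.autOfUnits_symm (T : LinearTrivialization V E S)
    (c : Y → (V →L[ℂ] V)ˣ) (y : Y) : (T.autOfUnits c y).symm = T.autOfUnits c⁻¹ y := by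
  by_cases h : y ∈ S
  · ext u
    rw [LinearEquiv.symm_apply_eq]
    apply (T.fiberEquiv y h).injective
    rw [T.fiberEquiv_autOfUnits c y h, T.fiberEquiv_autOfUnits _ y h, Pi.inv_apply,
      ← mul_apply_eq_comp, Units.mul_inv]
    rfl
  · simp [autOfUnits, h]

/-- If `c` is continuous on `S` and is `1` near the complement of `S`, the automorphism it defines
is continuous. -/
theorem LinearTrivialization.continuous_totalMap_autOfUnits [∀ y, TopologicalSpace (E y)]
    [FiberBundle V E] (T : LinearTrivialization V E S) {c : Y → (V →L[ℂ] V)ˣ}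
    (hc : ContinuousOn c S) (hc' : ∀ y ∉ S, ∀ᶠ z in 𝓝 y, c z = 1) :
    Continuous (fun p : TotalSpace V E => (⟨p.1, T.autOfUnits c p.1 p.2⟩ : TotalSpace V E)) := by
  rw [continuous_iff_continuousAt]
  intro p
  by_cases hp : p.1 ∈ S
  · have hsrc : ∀ q : TotalSpace V E, q ∈ T.source ↔ q.1 ∈ S := fun q => by
      rw [T.toTrivialization.mem_source, T.baseSet_eq]
    refine ContinuousOn.continuousAt (s := T.source) ?_ (T.open_source.mem_nhds ((hsrc p).2 hp))
    have h1 : ContinuousOn (fun q : TotalSpace V E =>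
        (q.1, (c q.1 : V →L[ℂ] V) (T.toTrivialization q).2)) T.source := by
      have hpr := (FiberBundle.continuous_proj V E).continuousOn (s := T.source)
      exact hpr.prodMk (((Units.continuous_val.comp_continuousOn hc).comp hpr fun q hq => (hsrc q).1 hq).clm_apply
        (continuous_snd.comp_continuousOn T.continuousOn))
    have h2 := T.toOpenPartialHomeomorph.symm.continuousOn.comp h1 (t := T.target) fun q hq => by
      rw [T.toTrivialization.mem_target, T.baseSet_eq]
      exact (hsrc q).1 hq
    refine h2.congr fun q hq => ?_
    have hq' := (hsrc q).1 hq
    have hq2 : (⟨q.1, T.autOfUnits c q.1 q.2⟩ : TotalSpace V E) ∈ T.source := (hsrc _).2 hq'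
    change _ = T.toOpenPartialHomeomorph.symm _
    rw [eq_comm]
    have := T.toOpenPartialHomeomorph.left_inv hq2
    rw [← this]
    congr 1
    refine Prod.ext (T.toTrivialization.coe_fst hq2).symm ?_
    exact (T.fiberEquiv_autOfUnits c q.1 hq' q.2).symm
  · refine continuousAt_id.congr ?_
    filter_upwards [((FiberBundle.continuous_proj V E).tendsto p).eventually (hc' p.1 hp)]
      with q hq
    rw [T.autOfUnits_eq_refl hq]
    rfl

end AutOfUnits

/-! ### Isomorphisms of glued bundles -/

section GluedIso

variable {X : Type*} [TopologicalSpace X] {A B : Opens X}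
  {V : Type*} [NormedAddCommGroup V] [NormedSpace ℂ V]
  {EA : A → Type*} [TopologicalSpace (TotalSpace V EA)] [∀ a, AddCommGroup (EA a)]
  [∀ a, Module ℂ (EA a)]
  {EB : B → Type*} [TopologicalSpace (TotalSpace V EB)] [∀ b, AddCommGroup (EB b)]
  [∀ b, Module ℂ (EB b)]
  (hAB : A ⊔ B = ⊤) (F F' : LinearTrivialization V EA {a : A | (a : X) ∈ B})
  (G G' : LinearTrivialization V EB {b : B | (b : X) ∈ A})
  [∀ a, TopologicalSpace (EA a)] [FiberBundle V EA] [VectorBundle ℂ V EA]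
  [∀ b, TopologicalSpace (EB b)] [FiberBundle V EB] [VectorBundle ℂ V EB]

/-- A family of maps between the fibres of glued bundles is continuous if its restrictions to
`E_A` and `E_B` come from continuous maps. -/
theorem continuous_glued_of_comp_incl (φ : ∀ x, Glued hAB F G x → Glued hAB F' G' x)
    (α : ∀ a, EA a → EA a) (β : ∀ b, EB b → EB b)
    (hα : Continuous fun p : TotalSpace V EA => (⟨p.1, α p.1 p.2⟩ : TotalSpace V EA))
    (hβ : Continuous fun p : TotalSpace V EB => (⟨p.1, β p.1 p.2⟩ : TotalSpace V EB))
    (hφα : ∀ (a : A) u, φ a (inclA hAB F G a u) = inclA hAB F' G' a (α a u))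
    (hφβ : ∀ (b : B) w, φ b (inclB hAB F G b w) = inclB hAB F' G' b (β b w)) :
    Continuous fun p : TotalSpace V (Glued hAB F G) =>
      (⟨p.1, φ p.1 p.2⟩ : TotalSpace V (Glued hAB F' G')) := by
  refine continuous_coinduced_dom.2 (continuous_sum_dom.2 ⟨?_, ?_⟩)
  · convert (continuous_totalMap_inclA hAB F' G').comp hα using 1
    funext p
    exact congrArg (TotalSpace.mk (F := V) (p.1 : X)) (hφα p.1 p.2)
  · convert (continuous_totalMap_inclB hAB F' G').comp hβ using 1
    funext p
    exact congrArg (TotalSpace.mk (F := V) (p.1 : X)) (hφβ p.1 p.2)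

/-- Automorphisms of `E_A` and `E_B` that carry one gluing relation to the other define an
isomorphism of the glued bundles. -/
theorem topologicallyEquivalent_glued [FiniteDimensional ℂ V]
    (α : ∀ a, EA a ≃ₗ[ℂ] EA a) (β : ∀ b, EB b ≃ₗ[ℂ] EB b)
    (hα : Continuous fun p : TotalSpace V EA => (⟨p.1, α p.1 p.2⟩ : TotalSpace V EA))
    (hα' : Continuous fun p : TotalSpace V EA => (⟨p.1, (α p.1).symm p.2⟩ : TotalSpace V EA))
    (hβ : Continuous fun p : TotalSpace V EB => (⟨p.1, β p.1 p.2⟩ : TotalSpace V EB))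
    (hβ' : Continuous fun p : TotalSpace V EB => (⟨p.1, (β p.1).symm p.2⟩ : TotalSpace V EB))
    (h : ∀ (x : X) (hA : x ∈ A) (hB : x ∈ B) (u : EA ⟨x, hA⟩) (w : EB ⟨x, hB⟩),
      F.fiberEquiv ⟨x, hA⟩ hB u = G.fiberEquiv ⟨x, hB⟩ hA w →
        F'.fiberEquiv ⟨x, hA⟩ hB (α _ u) = G'.fiberEquiv ⟨x, hB⟩ hA (β _ w)) :
    TopologicallyEquivalent V (Glued hAB F G) (Glued hAB F' G') := by
  classical
  let φ : ∀ x, Glued hAB F G x ≃ₗ[ℂ] Glued hAB F' G' x := fun x =>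
    if hx : x ∈ A then
      (inclA hAB F G ⟨x, hx⟩).symm.trans ((α ⟨x, hx⟩).trans (inclA hAB F' G' ⟨x, hx⟩))
    else
      (inclB hAB F G ⟨x, mem_right_of_not_mem_left hAB hx⟩).symm.trans
        ((β ⟨x, mem_right_of_not_mem_left hAB hx⟩).trans
          (inclB hAB F' G' ⟨x, mem_right_of_not_mem_left hAB hx⟩))
  have hφA : ∀ (a : A) u, φ a (inclA hAB F G a u) = inclA hAB F' G' a (α a u) := by
    rintro ⟨x, hx⟩ u
    simp only [φ, hx, dite_true, LinearEquiv.trans_apply, LinearEquiv.symm_apply_apply]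
  have hφB : ∀ (b : B) w, φ b (inclB hAB F G b w) = inclB hAB F' G' b (β b w) := by
    rintro ⟨x, hx⟩ w
    by_cases hA : x ∈ A
    · obtain ⟨u, hu⟩ := (inclA hAB F G ⟨x, hA⟩).surjective (inclB hAB F G ⟨x, hx⟩ w)
      rw [← hu]
      refine (hφA ⟨x, hA⟩ u).trans ?_
      exact (inclA_eq_inclB_iff hAB F' G' x hA hx _ _).2
        (h x hA hx u w ((inclA_eq_inclB_iff hAB F G x hA hx u w).1 hu))
    · simp only [φ, hA, dite_false, LinearEquiv.trans_apply, LinearEquiv.symm_apply_apply]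
  have hφA' : ∀ (a : A) u, (φ a).symm (inclA hAB F' G' a u) = inclA hAB F G a ((α a).symm u) := by
    intro a u
    rw [LinearEquiv.symm_apply_eq, hφA, LinearEquiv.apply_symm_apply]
  have hφB' : ∀ (b : B) w, (φ b).symm (inclB hAB F' G' b w) = inclB hAB F G b ((β b).symm w) := by
    intro b w
    rw [LinearEquiv.symm_apply_eq, hφB, LinearEquiv.apply_symm_apply]
  refine ⟨φ, isHomeomorph_iff_exists_inverse.2
    ⟨continuous_glued_of_comp_incl hAB F F' G G' (fun x => φ x) (fun a => α a) (fun b => β b)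
        hα hβ hφA hφB,
      fun p => ⟨p.1, (φ p.1).symm p.2⟩, fun p => by simp, fun p => by simp,
      continuous_glued_of_comp_incl hAB F' F G' G (fun x => (φ x).symm) (fun a => (α a).symm)
        (fun b => (β b).symm) hα' hβ' hφA' hφB'⟩⟩

end GluedIso

/-! ### Transition functions -/

namespace LinearTrivialization

section Transition

variable {Y : Type*} [TopologicalSpace Y] {V : Type*} [NormedAddCommGroup V] [NormedSpace ℂ V]
  [FiniteDimensional ℂ V]
  {E : Y → Type*} [TopologicalSpace (TotalSpace V E)] [∀ y, AddCommGroup (E y)]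
  [∀ y, Module ℂ (E y)] {S : Set Y}

open scoped Classical in
/-- The transition function from the trivialization `T` to the trivialization `T'` over `S`,
extended by `1` outside `S`. -/
def transition (T T' : LinearTrivialization V E S) (y : Y) : (V →L[ℂ] V)ˣ :=
  if h : y ∈ S then
    ((T.fiberEquiv y h).symm.trans (T'.fiberEquiv y h)).toContinuousLinearEquiv.toUnit
  else 1

theorem transition_apply (T T' : LinearTrivialization V E S) {y : Y} (h : y ∈ S) (v : V) :
    (T.transition T' y : V →L[ℂ] V) v = T'.fiberEquiv y h ((T.fiberEquiv y h).symm v) := by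
  simp only [transition, h, dite_true]
  rfl

theorem transition_of_notMem (T T' : LinearTrivialization V E S) {y : Y} (h : y ∉ S) :
    T.transition T' y = 1 := by
  simp [transition, h]

variable {M : Type*} [NormedAddCommGroup M] [NormedSpace ℂ M] [ChartedSpace M Y]
    [∀ y, TopologicalSpace (E y)] [FiberBundle V E] {T T' : LinearTrivialization V E S}

theorem IsHolomorphic.contMDiffOn_transition_apply (hT : T.IsHolomorphic (M := M))
    (hT' : T'.IsHolomorphic (M := M)) (v : V) :
    ContMDiffOn 𝓘(ℂ, M) 𝓘(ℂ, V) ω (fun y => (T.transition T' y : V →L[ℂ] V) v) S := by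
  have h1 : ContMDiffOn 𝓘(ℂ, M) (𝓘(ℂ, M).prod 𝓘(ℂ, V)) ω (fun y : Y => (y, v)) S :=
    contMDiffOn_id.prodMk contMDiffOn_const
  have htgt : ∀ y ∈ S, (y, v) ∈ T.target := fun y hy => by
    rw [T.toTrivialization.mem_target, T.baseSet_eq]
    exact hy
  have h2 := hT.contMDiffOn_symm.comp h1 htgt
  have h3 := hT'.contMDiffOn.comp h2 fun y hy => by
    change _ ∈ T'.source
    rw [T'.toTrivialization.mem_source, T'.baseSet_eq]
    change (T.toOpenPartialHomeomorph.symm (y, v)).1 ∈ S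
    have := T.toTrivialization.proj_symm_apply (htgt y hy)
    exact this ▸ hy
  refine (contMDiff_snd.comp_contMDiffOn h3).congr fun y hy => ?_
  rw [transition_apply T T' hy, fiberEquiv_apply]
  change _ = (T'.toTrivialization (T.toOpenPartialHomeomorph.symm (y, v))).2
  have hsrc : (⟨y, (T.fiberEquiv y hy).symm v⟩ : TotalSpace V E) ∈ T.source := by
    rw [T.toTrivialization.mem_source, T.baseSet_eq]
    exact hy
  rw [← T.toOpenPartialHomeomorph.left_inv hsrc]
  congr 3
  refine Prod.ext (T.toTrivialization.coe_fst hsrc) ?_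
  exact (T.fiberEquiv y hy).apply_symm_apply v

theorem IsHolomorphic.continuousOn_transition (hT : T.IsHolomorphic (M := M))
    (hT' : T'.IsHolomorphic (M := M)) : ContinuousOn (T.transition T') S := by
  rw [Units.isOpenEmbedding_val.isInducing.continuousOn_iff]
  exact continuousOn_clm_apply.2 fun v => (hT.contMDiffOn_transition_apply hT' v).continuousOn

end Transition

end LinearTrivialization

section Isotopy

variable {X : Type*} [TopologicalSpace X] [T2Space X] [ParacompactSpace X] {A B : Opens X}
  {V : Type*} [NormedAddCommGroup V] [NormedSpace ℂ V] [FiniteDimensional ℂ V]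
  {EA : A → Type*} [TopologicalSpace (TotalSpace V EA)] [∀ a, AddCommGroup (EA a)]
  [∀ a, Module ℂ (EA a)]
  {EB : B → Type*} [TopologicalSpace (TotalSpace V EB)] [∀ b, AddCommGroup (EB b)]
  [∀ b, Module ℂ (EB b)]
  [∀ a, TopologicalSpace (EA a)] [FiberBundle V EA] [VectorBundle ℂ V EA]
  [∀ b, TopologicalSpace (EB b)] [FiberBundle V EB] [VectorBundle ℂ V EB]

/-- Homotopic gluing maps give equivalent bundles: if the transition function `g` from `G` to `G'`
is joined to `1` by a homotopy `H`, then `g = (H ρ) * (g⁻¹ * H ρ)⁻¹` for a function `ρ` that is `0`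
near the complement of `B` and `1` near the complement of `A`. The first factor extends to `A` and
the second one to `B`. -/
theorem topologicallyEquivalent_glued_of_homotopy (hAB : A ⊔ B = ⊤)
    (F : LinearTrivialization V EA {a : A | (a : X) ∈ B})
    (G G' : LinearTrivialization V EB {b : B | (b : X) ∈ A})
    (hg : ContinuousOn (G.transition G') {b : B | (b : X) ∈ A})
    (H : C(unitInterval × (A ⊓ B : Opens X), (V →L[ℂ] V)ˣ)) (H0 : ∀ x, H (0, x) = 1)
    (H1 : ∀ x, H (1, x) = G.transition G' ⟨x, x.2.2⟩) :
    TopologicallyEquivalent V (Glued hAB F G) (Glued hAB F G') := by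
  classical
  obtain ⟨f, hf0, hf1, -⟩ := exists_continuous_zero_one_of_isClosed B.isOpen.isClosed_compl
    A.isOpen.isClosed_compl (disjoint_left.2 fun x hB hA => hB (mem_right_of_not_mem_left hAB hA))
  -- Rescaling makes the cutoff function locally constant near the two closed sets.
  let ρ : X → unitInterval := fun x => projIcc 0 1 zero_le_one (3 * f x - 1)
  have hρ : Continuous ρ := continuous_projIcc.comp (by fun_prop)
  have hρ0 : ∀ x ∉ B, ∀ᶠ y in 𝓝 x, ρ y = 0 := fun x hx => by
    have : f x < 1 / 3 := by rw [hf0 hx]; norm_num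
    filter_upwards [f.continuous.continuousAt.eventually_lt_const this] with y hy
    exact projIcc_of_le_left _ (by linarith)
  have hρ1 : ∀ x ∉ A, ∀ᶠ y in 𝓝 x, ρ y = 1 := fun x hx => by
    have : 2 / 3 < f x := by rw [hf1 hx]; norm_num
    filter_upwards [f.continuous.continuousAt.eventually_const_lt this] with y hy
    exact projIcc_of_right_le _ (by linarith)
  let k : X → (V →L[ℂ] V)ˣ := fun x => if h : x ∈ A ⊓ B then H (ρ x, ⟨x, h⟩) else 1
  have hk : ContinuousOn k (A ⊓ B : Opens X) := by
    rw [continuousOn_iff_continuous_domRestrict]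
    have : Continuous fun x : (A ⊓ B : Opens X) => H (ρ x, x) := by fun_prop
    refine this.congr fun x => ?_
    have hx : k x = H (ρ x, ⟨x, x.2⟩) := dif_pos x.2
    exact hx.symm
  have hk0 : ∀ x ∉ B, ∀ᶠ y in 𝓝 x, k y = 1 := fun x hx => by
    filter_upwards [hρ0 x hx] with y hy
    simp only [k, hy, H0, dite_eq_ite, ite_self]
  let kA : A → (V →L[ℂ] V)ˣ := fun a => k a
  let kB : B → (V →L[ℂ] V)ˣ := fun b => (G.transition G' b)⁻¹ * k b
  have hkA : ContinuousOn kA {a : A | (a : X) ∈ B} :=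
    hk.comp continuous_subtype_val.continuousOn fun a ha => ⟨a.2, ha⟩
  have hkB : ContinuousOn kB {b : B | (b : X) ∈ A} :=
    hg.inv.mul (hk.comp continuous_subtype_val.continuousOn fun b hb => ⟨hb, b.2⟩)
  have hkA1 : ∀ a ∉ {a : A | (a : X) ∈ B}, ∀ᶠ z in 𝓝 a, kA z = 1 := fun a ha =>
    (continuous_subtype_val.tendsto a).eventually (hk0 a ha)
  have hkB1 : ∀ b ∉ {b : B | (b : X) ∈ A}, ∀ᶠ z in 𝓝 b, kB z = 1 := fun b hb => by
    filter_upwards [(continuous_subtype_val.tendsto b).eventually (hρ1 b hb)] with z hz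
    by_cases h : (z : X) ∈ A
    · have hz' : (z : X) ∈ A ⊓ B := ⟨h, z.2⟩
      simp only [kB, k, hz', dite_true, hz, H1, inv_mul_cancel]
    · have hz' : (z : X) ∉ A ⊓ B := fun h' => h h'.1
      simp only [kB, k, hz', dite_false, mul_one, inv_eq_one]
      exact G.transition_of_notMem G' h
  refine topologicallyEquivalent_glued hAB F F G G' (F.autOfUnits kA) (G.autOfUnits kB)
    (F.continuous_totalMap_autOfUnits hkA hkA1) ?_ (G.continuous_totalMap_autOfUnits hkB hkB1) ?_ ?_
  · simp only [LinearTrivialization.autOfUnits_symm]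
    refine F.continuous_totalMap_autOfUnits hkA.inv fun a ha => ?_
    filter_upwards [hkA1 a ha] with z hz using by simp [hz]
  · simp only [LinearTrivialization.autOfUnits_symm]
    refine G.continuous_totalMap_autOfUnits hkB.inv fun b hb => ?_
    filter_upwards [hkB1 b hb] with z hz using by simp [hz]
  · intro x hA hB u w huw
    have h1 := G.transition_apply G' (y := ⟨x, hB⟩) hA
      (G.fiberEquiv ⟨x, hB⟩ hA (G.autOfUnits kB ⟨x, hB⟩ w))
    rw [LinearEquiv.symm_apply_apply] at h1
    rw [← h1, F.fiberEquiv_autOfUnits kA ⟨x, hA⟩ hB, G.fiberEquiv_autOfUnits kB ⟨x, hB⟩ hA, huw,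
      ← mul_apply_eq_comp, ← Units.val_mul]
    simp only [kA, kB, mul_inv_cancel_left]

end Isotopy

end BundleGluing

end

theorem proposition2p1 (m n : ℕ) (hm : 2 ≤ m)
    {X : Type*} [TopologicalSpace X] [T2Space X] [ParacompactSpace X]
    [ChartedSpace (EuclideanSpace ℂ (Fin m)) X]
    [IsManifold 𝓘(ℂ, EuclideanSpace ℂ (Fin m)) ω X]
    (A B : Opens X) (hAB : A ⊔ B = ⊤)
    (hC : Nonempty (Diffeomorph 𝓘(ℂ, EuclideanSpace ℂ (Fin m)) 𝓘(ℂ, EuclideanSpace ℂ (Fin m))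
      (A ⊓ B : Opens X) (Opens.mk {z : EuclideanSpace ℂ (Fin m) | z ≠ 0} isOpen_ne) ω))
    (EA : A → Type*) [∀ a, AddCommGroup (EA a)] [∀ a, Module ℂ (EA a)]
    [∀ a, TopologicalSpace (EA a)] [TopologicalSpace (TotalSpace (EuclideanSpace ℂ (Fin n)) EA)]
    [FiberBundle (EuclideanSpace ℂ (Fin n)) EA] [VectorBundle ℂ (EuclideanSpace ℂ (Fin n)) EA]
    [ContMDiffVectorBundle ω (EuclideanSpace ℂ (Fin n)) EA 𝓘(ℂ, EuclideanSpace ℂ (Fin m))]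
    (EB : B → Type*) [∀ b, AddCommGroup (EB b)] [∀ b, Module ℂ (EB b)]
    [∀ b, TopologicalSpace (EB b)] [TopologicalSpace (TotalSpace (EuclideanSpace ℂ (Fin n)) EB)]
    [FiberBundle (EuclideanSpace ℂ (Fin n)) EB] [VectorBundle ℂ (EuclideanSpace ℂ (Fin n)) EB]
    [ContMDiffVectorBundle ω (EuclideanSpace ℂ (Fin n)) EB 𝓘(ℂ, EuclideanSpace ℂ (Fin m))]
    (F : BundleGluing.LinearTrivialization (EuclideanSpace ℂ (Fin n)) EA {a : A | (a : X) ∈ B})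
    (G₀ G₁ : BundleGluing.LinearTrivialization (EuclideanSpace ℂ (Fin n)) EB {b : B | (b : X) ∈ A})
    (hF : F.IsHolomorphic (M := EuclideanSpace ℂ (Fin m)))
    (hG₀ : G₀.IsHolomorphic (M := EuclideanSpace ℂ (Fin m)))
    (hG₁ : G₁.IsHolomorphic (M := EuclideanSpace ℂ (Fin m))) :
    BundleGluing.TopologicallyEquivalent (EuclideanSpace ℂ (Fin n))
      (BundleGluing.Glued hAB F G₀) (BundleGluing.Glued hAB F G₁) := by
  classical
  obtain ⟨ψ⟩ := hC
  let j : (A ⊓ B : Opens X) → B := Opens.inclusion inf_le_right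
  have hj : ∀ x, j x ∈ {b : B | (b : X) ∈ A} := fun x => x.2.1
  -- The transition function, read on `ℂᵐ`, with a junk value at the origin.
  let g : EuclideanSpace ℂ (Fin m) →
      (EuclideanSpace ℂ (Fin n) →L[ℂ] EuclideanSpace ℂ (Fin n))ˣ := fun z =>
    if h : z ≠ 0 then G₀.transition G₁ (j (ψ.symm ⟨z, h⟩)) else 1
  have hg : DifferentiableOn ℂ (fun z =>
      (g z : EuclideanSpace ℂ (Fin n) →L[ℂ] EuclideanSpace ℂ (Fin n))) {0}ᶜ := by
    have : ContDiffOn ℂ 1 (fun z =>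
        (g z : EuclideanSpace ℂ (Fin n) →L[ℂ] EuclideanSpace ℂ (Fin n))) {0}ᶜ := by
      refine contDiffOn_clm_apply.2 fun v z hz => ContDiffAt.contDiffWithinAt ?_
      refine ContDiffAt.of_le (contMDiffAt_iff_contDiffAt.1 ?_) (m := 1) (n := ω) le_top
      refine (contMDiffAt_subtype_iff (x := (⟨z, hz⟩ : Opens.mk _ isOpen_ne))).1 ?_
      have h := (hG₀.contMDiffOn_transition_apply hG₁ v).comp_contMDiff
        ((contMDiff_inclusion inf_le_right).comp ψ.symm.contMDiff) fun z => hj (ψ.symm z)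
      refine (h.congr fun y => ?_).contMDiffAt
      have : g y = G₀.transition G₁ (j (ψ.symm y)) := dif_pos y.2
      rw [this]
      rfl
    exact this.differentiableOn one_ne_zero
  -- Two coordinate vectors, as `2 ≤ m`.
  have he : ‖(EuclideanSpace.single ⟨0, by omega⟩ 1 : EuclideanSpace ℂ (Fin m))‖ = 1 := by simp
  have he' : (EuclideanSpace.single ⟨1, by omega⟩ 1 : EuclideanSpace ℂ (Fin m)) ∉
      Submodule.span ℂ {EuclideanSpace.single ⟨0, by omega⟩ 1} := fun h => by
    obtain ⟨c, hc⟩ := Submodule.mem_span_singleton.1 h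
    simpa using congrArg (fun w : EuclideanSpace ℂ (Fin m) => w ⟨1, by omega⟩) hc
  obtain ⟨g', hg'⟩ := exists_continuousMap_units_eqOn hg he he'
  obtain ⟨H⟩ := homotopic_const_one_units finite_spectrum_continuousLinearMap g'
  refine BundleGluing.topologicallyEquivalent_glued_of_homotopy hAB F G₀ G₁
    (hG₀.continuousOn_transition hG₁)
    ⟨fun p => H (p.1, ψ p.2), H.continuous.comp (by
      have := ψ.continuous
      fun_prop)⟩ (fun x => ?_) fun x => ?_
  · simp
  · have hx : g (ψ x) = G₀.transition G₁ (j x) := by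
      refine (dif_pos (ψ x).2).trans ?_
      exact congrArg (fun y => G₀.transition G₁ (j y)) (ψ.symm_apply_apply x)
    refine (H.apply_one _).trans ((hg' (ψ x).2).trans hx)
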